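/- Let $X$ be a set, let $Y$ be a finite set of $L=|Y|$ labels, let $1\le k,k'\le L$, and write $\binom{Y}{k}$ for the set of $k$-element subsets of $Y$. Let $H$ be a nonempty class of $k'$ multi-labeled hypotheses $h\colon X\to\binom{Y}{k'}$ (single-labeled hypotheses $h\colon X\to Y$ are the case $k'=1$, with $h(x)$ identified with $\{h(x)\}$). A finite sequence $S=((x_1,y_1),\dots,(x_T,y_T))$ in $X\times Y$ is realizable by $H$ if some $h\in H$ satisfies $y_t\in h(x_t)$ for all $t$. A complete $(k+1)$-ary mistake tree of depth $n$ is a complete rooted tree of depth $n$ in which every internal node is labeled by a point of $X$ and has $k+1$ outgoing edges, labeled by pairwise different elements of $Y$. It is shattered by $H$ if for each of its root-to-leaf paths the induced sequence of $n$ examples (node label, label of the outgoing edge) is realizable by $H$. The $(k+1)$-ary Littlestone dimension $\mathtt{L}_k(H)\in\mathbb{N}\cup\{\infty\}$ is the largest depth of a complete $(k+1)$-ary mistake tree shattered by $H$, and $\infty$ if there are such trees of arbitrarily large depth. A (randomized) $k$-list learner $A$ maps every finite sequence $S$ of examples and every $x\in X$ to a probability distribution $A(x;S)$ on $\binom{Y}{k}$.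 Its expected number of mistakes on $S$ is $M(A;S)=\sum_{t=1}^{T}\Pr_{\hat L\sim A(x_t;S_{<t})}[y_t\notin\hat L]$, where $S_{<t}$ consists of the first $t-1$ examples of $S$, and its regret is $$R_H(A;S)=M(A;S)-\min_{h\in H}\bigl|\{t\le T: y_t\notin h(x_t)\}\bigr| .$$ The class $H$ is $k$-list agnostically online learnable if there are a $k$-list learner $A$ and a function $R\colon\mathbb{N}\to\mathbb{R}$ with $R(T)=o(T)$ such that $R_H(A;S)\le R(T)$ for every $T$ and every sequence $S$ of length $T$. Then the following two statements are equivalent: 1. $H$ is $k$-list agnostically online learnable. 2. $\mathtt{L}_k(H)<\infty$. Quantitatively, there is an absolute constant $C>0$ such that for all $X,Y,k,k',H$ as above with $d=\mathtt{L}_k(H)<\infty$ there is a single $k$-list learner $A$ such that, for every $T$ with $T\lceil\frac{L-k}{k}\rceil k\ge 2d$ and every sequence $S$ of length $T$, $$R_H(A;S)\le C\sqrt{dT\ln\Bigl(\frac{T}{d}\Bigl\lceil\frac{L-k}{k}\Bigr\rceil k\Bigr)},$$ where the right-hand side is read as $0$ if $d=0$. -/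

import Mathlib

open Asymptotics Filter

/-- The set of all lists (subsets) of exactly `k` labels, i.e. `binom(Y, k)`. -/
abbrev KList (Y : Type*) (k : ℕ) : Type _ := {L : Finset Y // L.card = k}

/-- A pattern: a finite sequence of examples, in chronological order. -/
abbrev Pattern (X Y : Type*) : Type _ := List (X × Y)

/-- `k` multi-labeled hypotheses; the single-labeled ones are the case `k = 1`. -/
abbrev MultiHypothesis (X Y : Type*) (k : ℕ) : Type _ := X → KList Y k

/-- The pattern class induced by a hypothesis class: all patterns consistent with some `h ∈ H`. -/
def patternClass {X Y : Type*} {k' : ℕ} (H : Set (MultiHypothesis X Y k')) :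
    Set (Pattern X Y) :=
  {S | ∃ h ∈ H, ∀ z ∈ S, z.2 ∈ (h z.1).1}

/-- Complete `b`-ary mistake trees, indexed by their depth: every internal node carries an unlabeled
example, and its `b` outgoing edges carry pairwise different labels. -/
inductive MistakeTree (X : Type*) (Y : Type*) (b : ℕ) : ℕ → Type _
  | leaf : MistakeTree X Y b 0
  | node {n : ℕ} (x : X) (y : Fin b ↪ Y) (child : Fin b → MistakeTree X Y b n) :
      MistakeTree X Y b (n + 1)

/-- The sequences of examples induced by the branches (root-to-leaf paths) of a mistake tree. -/
def MistakeTree.branches {X Y : Type*} {b : ℕ} :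
    {n : ℕ} → MistakeTree X Y b n → Set (Pattern X Y)
  | _, .leaf => {[]}
  | _, .node x y child => {S | ∃ i, ∃ S' ∈ (child i).branches, S = (x, y i) :: S'}

/-- A mistake tree is shattered by `P` if each of its branches induces a pattern in `P`. -/
def MistakeTree.IsShatteredBy {X Y : Type*} {b n : ℕ} (t : MistakeTree X Y b n)
    (P : Set (Pattern X Y)) : Prop :=
  ∀ S ∈ t.branches, S ∈ P

/-- `L_k(P)`, the `(k+1)`-ary Littlestone dimension: the largest depth of a complete `(k+1)`-ary
mistake tree shattered by `P`, and `⊤` if there are such trees of arbitrarily large depth. -/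
noncomputable def littlestoneDim {X Y : Type*} (k : ℕ) (P : Set (Pattern X Y)) : ℕ∞ :=
  ⨆ n ∈ {n : ℕ | ∃ t : MistakeTree X Y (k + 1) n, t.IsShatteredBy P}, (n : ℕ∞)

/-- A randomized `k`-list learner: from the past examples and the current point it computes a
probability distribution over the lists of `k` labels. -/
abbrev ListLearner (X Y : Type*) [Fintype Y] (k : ℕ) : Type _ :=
  Pattern X Y → X → stdSimplex ℝ (KList Y k)

/-- The probability that the random list with distribution `q` does not contain `y`. -/
noncomputable def missProb {Y : Type*} [Fintype Y] [DecidableEq Y] {k : ℕ}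
    (q : stdSimplex ℝ (KList Y k)) (y : Y) : ℝ :=
  ∑ L : KList Y k, if y ∈ L.1 then 0 else q.1 L

/-- `M(A; S)`, the expected number of mistakes of a randomized list learner on `S`. -/
noncomputable def learnerMistakes {X Y : Type*} [Fintype Y] [DecidableEq Y] {k : ℕ}
    (A : ListLearner X Y k) (S : Pattern X Y) : ℝ :=
  ∑ t : Fin S.length, missProb (A (S.take t) (S.get t).1) (S.get t).2

/-- `M(h; S)`, the number of mistakes of a multi-labeled hypothesis on `S`. -/
def hypothesisMistakes {X Y : Type*} [DecidableEq Y] {k' : ℕ}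
    (h : MultiHypothesis X Y k') (S : Pattern X Y) : ℕ :=
  S.countP (fun z => z.2 ∉ (h z.1).1)

/-- `R_H(A; S) = M(A; S) - min_{h ∈ H} M(h; S)`, for a nonempty class `H` (the infimum of a nonempty
set of natural numbers is its minimum). -/
noncomputable def regret {X Y : Type*} [Fintype Y] [DecidableEq Y] {k k' : ℕ}
    (H : Set (MultiHypothesis X Y k')) (A : ListLearner X Y k) (S : Pattern X Y) : ℝ :=
  learnerMistakes A S - (sInf ((fun h => hypothesisMistakes h S) '' H) : ℕ)

/-- `H` is `k`-list agnostically online learnable: a single randomized `k`-list learner has, on all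
sequences of length `T` and for every `T`, regret at most `R T`, where `R T = o(T)`. -/
def AgnosticListLearnable {X Y : Type*} [Fintype Y] [DecidableEq Y] {k' : ℕ} (k : ℕ)
    (H : Set (MultiHypothesis X Y k')) : Prop :=
  ∃ (A : ListLearner X Y k) (R : ℕ → ℝ),
    R =o[atTop] (fun T : ℕ => (T : ℝ)) ∧
    ∀ (T : ℕ) (S : Pattern X Y), S.length = T → regret H A S ≤ R T

/-! Lower bound: a list of `k` labels misses one of any `k + 1` distinct labels, so at each node of
a mistake tree some edge is missed with probability at least `1 / (k + 1)`. Following these edges in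
a shattered tree of depth `n` costs the learner `n / (k + 1)`, while some hypothesis makes no
mistake. Trees of unbounded depth therefore rule out sublinear regret.

Upper bound: if `H` has dimension `d`, the standard optimal algorithm predicts the labels whose
restricted class keeps the current dimension bound; there are at most `k` of them. Fix `h ∈ H` and
update the version space only when `h` is right and the list is wrong. The bound drops at each
update, so there are at most `d` updates, and all other mistakes are shared with `h`
(`exists_optimalExpert_le`). The learner does not know `h`, so it runs exponential weights over all
update schedules, with a product prior that favours schedules with few updates
(`learnerMistakes_hedge_le`, `exists_learner_horizon`). Doubling the horizon gives one learner for
all `T` (`learnerMistakes_doublingLearner_le`). -/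

/-! ### Losses accumulated along a sequence. -/

section CumulativeLoss

variable {α : Type*}

/-- The total loss on a sequence, when the loss of each round depends on the past and on the
current item. -/
def cumLoss (c : List α → α → ℝ) (S : List α) : ℝ :=
  ∑ t : Fin S.length, c (S.take t) (S.get t)

@[simp] lemma cumLoss_nil (c : List α → α → ℝ) : cumLoss c [] = 0 := by
  simp [cumLoss]

lemma cumLoss_cons (c : List α → α → ℝ) (z : α) (S : List α) :
    cumLoss c (z :: S) = c [] z + cumLoss (fun P => c (z :: P)) S := by
  simp [cumLoss, Fin.sum_univ_succ]

lemma cumLoss_append (c : List α → α → ℝ) (S S' : List α) :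
    cumLoss c (S ++ S') = cumLoss c S + cumLoss (fun P => c (S ++ P)) S' := by
  induction S generalizing c with
  | nil => simp
  | cons z S ih => simp [cumLoss_cons, ih, add_assoc]

lemma cumLoss_singleton (c : List α → α → ℝ) (z : α) : cumLoss c [z] = c [] z := by
  simp [cumLoss_cons]

lemma cumLoss_congr {c c' : List α → α → ℝ} {S : List α}
    (h : ∀ P z, P.length < S.length → c P z = c' P z) : cumLoss c S = cumLoss c' S := by
  refine Finset.sum_congr rfl fun t _ => h _ _ ?_
  have := t.2
  simp

lemma cumLoss_le_length {c : List α → α → ℝ} (h : ∀ P z, c P z ≤ 1) (S : List α) :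
    cumLoss c S ≤ S.length := by
  refine (Finset.sum_le_sum fun t _ => h _ _).trans ?_
  simp

end CumulativeLoss

/-! ### Mistake counts and regret. -/

section Learners

variable {X Y : Type*} [DecidableEq Y] {k k' : ℕ}

lemma hypothesisMistakes_cons (h : MultiHypothesis X Y k') (z : X × Y) (S : Pattern X Y) :
    (hypothesisMistakes h (z :: S) : ℝ) =
      (if z.2 ∈ (h z.1).1 then 0 else 1) + hypothesisMistakes h S := by
  unfold hypothesisMistakes
  rw [List.countP_cons]
  by_cases hz : z.2 ∈ (h z.1).1 <;> simp [hz, add_comm]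

lemma hypothesisMistakes_append (h : MultiHypothesis X Y k') (S S' : Pattern X Y) :
    hypothesisMistakes h (S ++ S') = hypothesisMistakes h S + hypothesisMistakes h S' :=
  List.countP_append

variable [Fintype Y]

lemma learnerMistakes_eq_cumLoss (A : ListLearner X Y k) (S : Pattern X Y) :
    learnerMistakes A S = cumLoss (fun P z => missProb (A P z.1) z.2) S := rfl

lemma missProb_le_one (q : stdSimplex ℝ (KList Y k)) (y : Y) : missProb q y ≤ 1 := by
  rw [← q.2.2]
  refine Finset.sum_le_sum fun L _ => ?_
  split_ifs
  · exact q.2.1 L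
  · exact le_rfl

lemma learnerMistakes_le_length (A : ListLearner X Y k) (S : Pattern X Y) :
    learnerMistakes A S ≤ S.length := by
  rw [learnerMistakes_eq_cumLoss]
  exact cumLoss_le_length (fun P z => missProb_le_one (A P z.1) z.2) S

lemma regret_le_of_forall {H : Set (MultiHypothesis X Y k')} (hH : H.Nonempty)
    {A : ListLearner X Y k} {S : Pattern X Y} {r : ℝ}
    (h : ∀ g ∈ H, learnerMistakes A S ≤ hypothesisMistakes g S + r) : regret H A S ≤ r := by
  obtain ⟨g, hg, hgS⟩ := Nat.sInf_mem (hH.image fun h => hypothesisMistakes h S)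
  have := h g hg
  unfold regret
  rw [← hgS]
  simp only
  linarith

end Learners

/-! ### Learnability forces finite dimension. -/

section LowerBound

variable {X Y : Type*} [Fintype Y] [DecidableEq Y] {k k' : ℕ}

/-- After exchanging the sums, each list contributes its full probability at least once, since it
cannot contain all `k + 1` labels. -/
lemma one_le_sum_missProb (q : stdSimplex ℝ (KList Y k)) (y : Fin (k + 1) ↪ Y) :
    1 ≤ ∑ i, missProb q (y i) := by
  unfold missProb
  rw [Finset.sum_comm, ← q.2.2]
  refine Finset.sum_le_sum fun L _ => ?_
  obtain ⟨i, hi⟩ : ∃ i, y i ∉ L.1 := by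
    by_contra! hall
    have : (Finset.univ.map y).card ≤ L.1.card :=
      Finset.card_le_card fun a ha => by
        obtain ⟨i, -, rfl⟩ := Finset.mem_map.1 ha
        exact hall i
    simp [L.2] at this
  have hle : ∀ j ∈ Finset.univ, 0 ≤ if y j ∈ L.1 then 0 else q.1 L := fun j _ => by
    split_ifs
    · exact le_rfl
    · exact q.2.1 L
  calc q.1 L = if y i ∈ L.1 then 0 else q.1 L := by simp [hi]
    _ ≤ _ := Finset.single_le_sum hle (Finset.mem_univ i)

lemma MistakeTree.length_of_mem_branches {X Y : Type*} {b n : ℕ} (t : MistakeTree X Y b n) :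
    ∀ S ∈ t.branches, S.length = n := by
  induction t with
  | leaf => rintro S rfl; rfl
  | node x y child ih =>
    rintro S ⟨i, S', hS', rfl⟩
    simp [ih i S' hS']

/-- The adversary takes an edge of at least average miss probability, then continues in that child
against the learner that has already seen this example. -/
lemma MistakeTree.exists_branch_le_learnerMistakes {n : ℕ} (t : MistakeTree X Y (k + 1) n)
    (A : ListLearner X Y k) :
    ∃ S ∈ t.branches, (n : ℝ) / (k + 1) ≤ learnerMistakes A S := by
  induction t generalizing A with
  | leaf => exact ⟨[], rfl, by simp [learnerMistakes_eq_cumLoss]⟩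
  | @node n x y child ih =>
    obtain ⟨i, hi⟩ : ∃ i, (1 : ℝ) / (k + 1) ≤ missProb (A [] x) (y i) := by
      by_contra! hlt
      have h1 := one_le_sum_missProb (A [] x) y
      have h2 := Finset.sum_lt_sum_of_nonempty (s := (Finset.univ : Finset (Fin (k + 1))))
        Finset.univ_nonempty fun i _ => hlt i
      have h3 : ∑ _i : Fin (k + 1), (1 : ℝ) / (k + 1) = 1 := by
        rw [Finset.sum_const, Finset.card_univ, Fintype.card_fin, nsmul_eq_mul]
        push_cast
        field_simp
      linarith
    obtain ⟨S, hS, hle⟩ := ih i fun P => A ((x, y i) :: P)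
    refine ⟨(x, y i) :: S, ⟨i, S, hS, rfl⟩, ?_⟩
    rw [learnerMistakes_eq_cumLoss] at hle ⊢
    rw [cumLoss_cons]
    push_cast
    rw [add_div]
    linarith

lemma regret_of_mem_patternClass {H : Set (MultiHypothesis X Y k')} (A : ListLearner X Y k)
    {S : Pattern X Y} (hS : S ∈ patternClass H) : regret H A S = learnerMistakes A S := by
  obtain ⟨h, hH, hh⟩ := hS
  have h0 : hypothesisMistakes h S = 0 := by
    unfold hypothesisMistakes
    rw [List.countP_eq_zero]
    intro z hz
    simpa using hh z hz
  have : sInf ((fun h => hypothesisMistakes h S) '' H) = 0 :=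
    Nat.eq_zero_of_le_zero (h0 ▸ Nat.sInf_le ⟨h, hH, rfl⟩)
  simp [regret, this]

lemma littlestoneDim_lt_top_of_agnosticListLearnable {H : Set (MultiHypothesis X Y k')}
    (hA : AgnosticListLearnable k H) : littlestoneDim k (patternClass H) < ⊤ := by
  obtain ⟨A, R, hR, hAR⟩ := hA
  by_contra htop
  rw [not_lt_top_iff] at htop
  -- Half of the rate `1 / (k + 1)` that the tree forces.
  have hev := hR.def (c := 1 / (2 * (k + 1) : ℝ)) (by positivity)
  obtain ⟨N, hN⟩ := eventually_atTop.1 hev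
  have hlt : ((N + 1 : ℕ) : ℕ∞) < littlestoneDim k (patternClass H) :=
    htop ▸ ENat.natCast_lt_top _
  unfold littlestoneDim at hlt
  obtain ⟨n, hn⟩ := lt_iSup_iff.1 hlt
  obtain ⟨⟨t, ht⟩, hn⟩ := lt_iSup_iff.1 hn
  have hn' : N + 1 < n := by exact_mod_cast hn
  obtain ⟨S, hS, hle⟩ := t.exists_branch_le_learnerMistakes A
  have hreg := hAR n S (t.length_of_mem_branches S hS)
  rw [regret_of_mem_patternClass A (ht S hS)] at hreg
  have h1 := (le_abs_self _).trans (hN n (by omega))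
  have hn0 : (0 : ℝ) < n := by exact_mod_cast (by omega : 0 < n)
  rw [Real.norm_of_nonneg hn0.le] at h1
  have h2 : (n : ℝ) / (k + 1) ≤ 1 / (2 * (k + 1)) * n := hle.trans (hreg.trans h1)
  have h3 : 1 / (2 * (k + 1) : ℝ) * n = n / (k + 1) / 2 := by field_simp
  have h4 : 0 < (n : ℝ) / (k + 1) := by positivity
  linarith

end LowerBound

/-! ### Exponential weights with a non-uniform prior. -/

section Hedge

variable {X Y E : Type*} [DecidableEq Y] {k : ℕ}

/-- The number of mistakes of a deterministic list learner. -/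
def expertMistakes (f : Pattern X Y → X → KList Y k) (S : Pattern X Y) : ℝ :=
  cumLoss (fun P z => if z.2 ∈ (f P z.1).1 then 0 else 1) S

lemma expertMistakes_cons (f : Pattern X Y → X → KList Y k) (z : X × Y) (S : Pattern X Y) :
    expertMistakes f (z :: S) =
      (if z.2 ∈ (f [] z.1).1 then 0 else 1) + expertMistakes (fun P => f (z :: P)) S :=
  cumLoss_cons _ _ _

/-- The weight of an expert in the exponential weights algorithm. -/
noncomputable def hedgeWeight (f : E → Pattern X Y → X → KList Y k) (p : E → ℝ) (η : ℝ)
    (S : Pattern X Y) (e : E) : ℝ :=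
  p e * Real.exp (-η * expertMistakes (f e) S)

lemma hedgeWeight_pos (f : E → Pattern X Y → X → KList Y k) {p : E → ℝ} (hp : ∀ e, 0 < p e)
    (η : ℝ) (S : Pattern X Y) (e : E) : 0 < hedgeWeight f p η S e :=
  mul_pos (hp e) (Real.exp_pos _)

variable [Fintype Y] [Fintype E]

/-- The distribution of the list `g e`, for `e` drawn with probability proportional to `w e`. -/
noncomputable def mixture [Nonempty E] (w : E → ℝ) (hw : ∀ e, 0 < w e) (g : E → KList Y k) :
    stdSimplex ℝ (KList Y k) :=
  ⟨fun L => ∑ e, if g e = L then w e / ∑ e', w e' else 0, by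
    have hW : 0 < ∑ e, w e := Finset.sum_pos (fun e _ => hw e) Finset.univ_nonempty
    refine ⟨fun L => Finset.sum_nonneg fun e _ => ?_, ?_⟩
    · have := hw e
      split_ifs <;> positivity
    · rw [Finset.sum_comm]
      simp only [Finset.sum_ite_eq, Finset.mem_univ, if_true]
      rw [← Finset.sum_div, div_self hW.ne']⟩

lemma missProb_mixture [Nonempty E] (w : E → ℝ) (hw : ∀ e, 0 < w e) (g : E → KList Y k) (y : Y) :
    missProb (mixture w hw g) y = (∑ e, if y ∈ (g e).1 then 0 else w e) / ∑ e, w e := by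
  unfold missProb mixture
  simp only
  have h1 : ∀ L : KList Y k,
      (if y ∈ L.1 then (0 : ℝ) else ∑ e, if g e = L then w e / ∑ e', w e' else 0) =
        ∑ e, if g e = L then (if y ∈ (g e).1 then 0 else w e / ∑ e', w e') else 0 := by
    intro L
    split_ifs with h
    · refine (Finset.sum_eq_zero fun e _ => ?_).symm
      split_ifs with h1 h2 <;> simp_all
    · refine Finset.sum_congr rfl fun e _ => ?_
      split_ifs with h1 h2 <;> simp_all
  simp_rw [h1]
  rw [Finset.sum_comm, Finset.sum_div]
  refine Finset.sum_congr rfl fun e _ => ?_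
  simp only [Finset.sum_ite_eq, Finset.mem_univ, if_true]
  split_ifs <;> simp

/-- The exponential weights learner with prior weights `p` and learning rate `η`. -/
noncomputable def hedge [Nonempty E] (f : E → Pattern X Y → X → KList Y k) (p : E → ℝ)
    (hp : ∀ e, 0 < p e) (η : ℝ) : ListLearner X Y k :=
  fun S x => mixture (hedgeWeight f p η S) (hedgeWeight_pos f hp η S) fun e => f e S x

/-- The total weight is a potential: a round with miss probability `m` multiplies it by exactly `1 -
(1 - exp (-η)) * m`. -/
lemma sum_hedgeWeight_le [Nonempty E] (f : E → Pattern X Y → X → KList Y k) (p : E → ℝ)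
    (hp : ∀ e, 0 < p e) (η : ℝ) (S : Pattern X Y) :
    ∑ e, hedgeWeight f p η S e ≤
      (∑ e, p e) * Real.exp (-(1 - Real.exp (-η)) * learnerMistakes (hedge f p hp η) S) := by
  induction S using List.reverseRecOn with
  | nil => simp [hedgeWeight, expertMistakes, learnerMistakes_eq_cumLoss]
  | append_singleton S z ih =>
    set W := ∑ e, hedgeWeight f p η S e with hW
    have hWpos : 0 < W :=
      Finset.sum_pos (fun e _ => hedgeWeight_pos f hp η S e) Finset.univ_nonempty
    set m := missProb (hedge f p hp η S z.1) z.2 with hm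
    have hm' : m * W = ∑ e, if z.2 ∈ (f e S z.1).1 then 0 else hedgeWeight f p η S e := by
      rw [hm, hedge, missProb_mixture, ← hW, div_mul_cancel₀ _ hWpos.ne']
    have hstep : ∑ e, hedgeWeight f p η (S ++ [z]) e = W * (1 - (1 - Real.exp (-η)) * m) := by
      have : W * (1 - (1 - Real.exp (-η)) * m) = W - (1 - Real.exp (-η)) * (m * W) := by ring
      rw [this, hm', hW, Finset.mul_sum, ← Finset.sum_sub_distrib]
      refine Finset.sum_congr rfl fun e _ => ?_
      simp only [hedgeWeight, expertMistakes, cumLoss_append, cumLoss_singleton, List.append_nil]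
      split_ifs
      · simp
      · rw [mul_add, Real.exp_add, mul_one]
        ring
    have hM : learnerMistakes (hedge f p hp η) (S ++ [z]) =
        learnerMistakes (hedge f p hp η) S + m := by
      simp only [learnerMistakes_eq_cumLoss, cumLoss_append, cumLoss_singleton, List.append_nil,
        hm]
    rw [hstep, hM, mul_add, Real.exp_add, ← mul_assoc]
    have h1 : 1 - (1 - Real.exp (-η)) * m ≤ Real.exp (-(1 - Real.exp (-η)) * m) := by
      have := Real.add_one_le_exp (-(1 - Real.exp (-η)) * m)
      linarith
    exact (mul_le_mul_of_nonneg_left h1 hWpos.le).trans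
      (mul_le_mul_of_nonneg_right ih (Real.exp_pos _).le)

/-- This follows from `exp (-η) ≤ 1 / (1 + η)` and `(1 - η + η ^ 2) * (1 + η) = 1 + η ^ 3`. -/
lemma sub_sq_le_one_sub_exp_neg {η : ℝ} (hη : 0 ≤ η) : η - η ^ 2 ≤ 1 - Real.exp (-η) := by
  have h1 := Real.add_one_le_exp η
  have h2 : Real.exp (-η) * Real.exp η = 1 := by rw [← Real.exp_add]; simp
  have h3 := Real.exp_pos (-η)
  have h4 : Real.exp (-η) * (η + 1) ≤ 1 := by nlinarith
  by_contra! h5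
  have h6 : (1 - η + η ^ 2) * (η + 1) < 1 := by nlinarith
  nlinarith [pow_nonneg hη 3]

/-- The final weight of the single expert `e` is at most the potential; take logarithms. An expert
pays only for its own share of the prior. -/
lemma learnerMistakes_hedge_le [Nonempty E] (f : E → Pattern X Y → X → KList Y k) (p : E → ℝ)
    (hp : ∀ e, 0 < p e) {η : ℝ} (hη : 0 < η) (S : Pattern X Y) (e : E) :
    learnerMistakes (hedge f p hp η) S ≤
      expertMistakes (f e) S + Real.log ((∑ e, p e) / p e) / η + η * S.length := by
  have hW0 : 0 < ∑ e, p e := Finset.sum_pos (fun e _ => hp e) Finset.univ_nonempty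
  set M := learnerMistakes (hedge f p hp η) S
  have hMT : M ≤ S.length := learnerMistakes_le_length _ _
  have hM0 : 0 ≤ M := Finset.sum_nonneg fun t _ => Finset.sum_nonneg fun L _ => by
    split_ifs
    · exact le_rfl
    · exact (hedge f p hp η _ _).2.1 L
  have h1 := (Finset.single_le_sum (fun e _ => (hedgeWeight_pos f hp η S e).le)
    (Finset.mem_univ e)).trans (sum_hedgeWeight_le f p hp η S)
  have h2 := Real.log_le_log (hedgeWeight_pos f hp η S e) h1
  rw [hedgeWeight, Real.log_mul (hp e).ne' (Real.exp_pos _).ne',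
    Real.log_mul hW0.ne' (Real.exp_pos _).ne', Real.log_exp, Real.log_exp] at h2
  have h3 : Real.log ((∑ e, p e) / p e) = Real.log (∑ e, p e) - Real.log (p e) :=
    Real.log_div hW0.ne' (hp e).ne'
  have h4 := mul_le_mul_of_nonneg_right (sub_sq_le_one_sub_exp_neg hη.le) hM0
  have h5 : η ^ 2 * M ≤ η ^ 2 * S.length := by gcongr
  have h6 : η * M ≤ η * (expertMistakes (f e) S + Real.log ((∑ e, p e) / p e) / η +
      η * S.length) := by
    have : η * (expertMistakes (f e) S + Real.log ((∑ e, p e) / p e) / η + η * S.length) =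
        η * expertMistakes (f e) S + Real.log ((∑ e, p e) / p e) + η ^ 2 * S.length := by
      field_simp
    rw [this, h3]
    change _ + -η * _ ≤ _ + -(1 - Real.exp (-η)) * M at h2
    linarith
  exact le_of_mul_le_mul_left h6 hη

end Hedge

/-! ### The standard optimal algorithm under a prescribed update schedule. -/

section StandardOptimalAlgorithm

variable {X Y : Type*} {k k' : ℕ}

/-- Some complete `(k + 1)`-ary mistake tree of depth `n` is shattered by `V`. -/
def ShattersDepth (k : ℕ) (V : Set (MultiHypothesis X Y k')) (n : ℕ) : Prop :=
  ∃ t : MistakeTree X Y (k + 1) n, t.IsShatteredBy (patternClass V)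

/-- The hypotheses of `V` that are consistent with the example `(x, y)`. -/
def restrictClass (V : Set (MultiHypothesis X Y k')) (x : X) (y : Y) :
    Set (MultiHypothesis X Y k') :=
  {h ∈ V | y ∈ (h x).1}

lemma shattersDepth_zero {V : Set (MultiHypothesis X Y k')} (hV : V.Nonempty) :
    ShattersDepth k V 0 := by
  obtain ⟨h, hh⟩ := hV
  refine ⟨.leaf, ?_⟩
  rintro S rfl
  exact ⟨h, hh, by simp⟩

lemma shattersDepth_succ {V : Set (MultiHypothesis X Y k')} {n : ℕ} (x : X)
    (y : Fin (k + 1) ↪ Y) (h : ∀ i, ShattersDepth k (restrictClass V x (y i)) n) :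
    ShattersDepth k V (n + 1) := by
  choose t ht using h
  refine ⟨.node x y t, ?_⟩
  rintro S ⟨i, S', hS', rfl⟩
  obtain ⟨g, hg, hgS⟩ := ht i S' hS'
  exact ⟨g, hg.1, by simpa using ⟨hg.2, fun a b hab => hgS (a, b) hab⟩⟩

lemma not_shattersDepth_of_littlestoneDim_eq {H : Set (MultiHypothesis X Y k')} {d : ℕ}
    (hd : littlestoneDim k (patternClass H) = d) : ¬ ShattersDepth k H (d + 1) := by
  intro h
  have h1 : ((d + 1 : ℕ) : ℕ∞) ≤ littlestoneDim k (patternClass H) :=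
    le_iSup₂ (f := fun (n : ℕ) (_ : n ∈ {n : ℕ | ∃ t : MistakeTree X Y (k + 1) n,
      t.IsShatteredBy (patternClass H)}) => (n : ℕ∞)) (d + 1) h
  rw [hd] at h1
  have : d + 1 ≤ d := by exact_mod_cast h1
  omega

variable [Fintype Y]

/-- If `k + 1` labels each left a class shattering depth `n`, joining their trees under a root at
`x` would give depth `n + 1`. -/
lemma exists_kList_of_not_shattersDepth (hk : k ≤ Fintype.card Y)
    {V : Set (MultiHypothesis X Y k')} {n : ℕ} (hV : ¬ ShattersDepth k V (n + 1)) (x : X) :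
    ∃ L : KList Y k, ∀ y, ShattersDepth k (restrictClass V x y) n → y ∈ L.1 := by
  classical
  set s := Finset.univ.filter fun y => ShattersDepth k (restrictClass V x y) n
  have hs : s.card ≤ k := by
    by_contra! hlt
    obtain ⟨s', hs', hcard⟩ := Finset.exists_subset_card_eq (Nat.succ_le_of_lt hlt)
    let y : Fin (k + 1) ↪ Y :=
      (s'.equivFinOfCardEq hcard).symm.toEmbedding.trans (Function.Embedding.subtype _)
    refine hV (shattersDepth_succ x y fun i => ?_)
    have : y i ∈ s := hs' ((s'.equivFinOfCardEq hcard).symm i).2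
    exact (Finset.mem_filter.1 this).2
  obtain ⟨L, hL, -, hcard⟩ := Finset.exists_subsuperset_card_eq s.subset_univ hs (by simpa using hk)
  exact ⟨⟨L, hcard⟩, fun y hy => hL (by simpa [s] using hy)⟩

/-- The prior factor of a round. -/
def updateWeight (q : ℝ) (o : Option Y) : ℝ := o.elim 1 fun _ => q

lemma sum_prod_updateWeight (q : ℝ) (n : ℕ) :
    ∑ e : Fin n → Option Y, ∏ i, updateWeight q (e i) = (1 + Fintype.card Y * q) ^ n := by
  have h := Finset.prod_univ_sum (fun _ : Fin n => (Finset.univ : Finset (Option Y)))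
    (fun _ o => updateWeight q o)
  rw [Fintype.piFinset_univ] at h
  rw [← h]
  simp [Fintype.sum_option, updateWeight]

variable [Nonempty (KList Y k)]

/-- A list of the labels `y` for which `V` restricted to `(x, y)` still shatters depth `n`. -/
noncomputable def optimalList (V : Set (MultiHypothesis X Y k')) (n : ℕ) (x : X) : KList Y k :=
  Classical.epsilon fun L : KList Y k =>
    ∀ y, ShattersDepth k (restrictClass V x y) n → y ∈ L.1

lemma mem_optimalList (hk : k ≤ Fintype.card Y) {V : Set (MultiHypothesis X Y k')} {n : ℕ}
    (hV : ¬ ShattersDepth k V (n + 1)) {x : X} {y : Y}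
    (hy : ShattersDepth k (restrictClass V x y) n) :
    y ∈ (optimalList (k := k) V n x).1 :=
  Classical.epsilon_spec (exists_kList_of_not_shattersDepth hk hV x) y hy

/-- The version space and the dimension bound after the rounds at which `e` prescribes a label
have been used for an update. -/
def versionSpace : (ℕ → Option Y) → Pattern X Y → Set (MultiHypothesis X Y k') × ℕ →
    Set (MultiHypothesis X Y k') × ℕ
  | _, [], s => s
  | e, z :: S, s => versionSpace (fun i => e (i + 1)) S
      ((e 0).elim s fun y => (restrictClass s.1 z.1 y, s.2 - 1))

/-- The standard optimal algorithm with the updates prescribed by `e`. -/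
noncomputable def optimalExpert (s : Set (MultiHypothesis X Y k') × ℕ) (e : ℕ → Option Y) :
    Pattern X Y → X → KList Y k :=
  fun S x => optimalList (versionSpace e S s).1 (versionSpace e S s).2 x

variable [DecidableEq Y]

/-- The schedule is read off from `h` and `S`. Its prior weight is at least `q ^ n` because it
prescribes at most `n` updates; the truncated subtraction in `versionSpace` is harmless here, as
updates occur only at positive dimension bounds. -/
lemma exists_optimalExpert_le (hk : k ≤ Fintype.card Y) {q : ℝ} (hq : 0 < q)
    (h : MultiHypothesis X Y k') (S : Pattern X Y) (V : Set (MultiHypothesis X Y k')) (n : ℕ)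
    (hh : h ∈ V) (hV : ¬ ShattersDepth k V (n + 1)) (hq1 : q ≤ 1) :
    ∃ e : ℕ → Option Y, (∀ i, S.length ≤ i → e i = none) ∧
      (∀ N, q ^ n ≤ ∏ i ∈ Finset.range N, updateWeight q (e i)) ∧
      expertMistakes (optimalExpert (k := k) (V, n) e) S ≤ hypothesisMistakes h S + n := by
  induction S generalizing V n with
  | nil =>
    refine ⟨fun _ => none, fun _ _ => rfl, fun N => ?_, ?_⟩
    · simpa [updateWeight] using pow_le_one₀ hq.le hq1
    · simp [expertMistakes]
      positivity
  | cons z S ih =>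
    -- These are the update rounds: `h` is right and the list is wrong.
    by_cases hz : z.2 ∈ (h z.1).1 ∧ z.2 ∉ (optimalList (k := k) V n z.1).1
    · have hV' : ¬ ShattersDepth k (restrictClass V z.1 z.2) n :=
        fun hs => hz.2 (mem_optimalList hk hV hs)
      have hh' : h ∈ restrictClass V z.1 z.2 := ⟨hh, hz.1⟩
      cases n with
      -- At bound `0` no update can occur: the restricted class still contains `h`, hence shatters
      -- depth `0`.
      | zero => exact absurd (shattersDepth_zero ⟨h, hh'⟩) hV'
      | succ n =>
        obtain ⟨e, he, hprod, hle⟩ := ih _ n hh' hV'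
        refine ⟨fun i => i.casesOn (some z.2) e, ?_, ?_, ?_⟩
        · rintro (_ | i) hi
          · simp at hi
          · exact he i (by simpa using hi)
        · rintro (_ | N)
          · simpa using pow_le_one₀ hq.le hq1
          · rw [Finset.prod_range_succ', pow_succ]
            exact mul_le_mul_of_nonneg_right (hprod N) hq.le
        · rw [expertMistakes_cons, hypothesisMistakes_cons, if_pos hz.1]
          change _ + expertMistakes (optimalExpert (restrictClass V z.1 z.2, n) e) S ≤ _
          push_cast
          split_ifs <;> linarith
    · obtain ⟨e, he, hprod, hle⟩ := ih V n hh hV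
      refine ⟨fun i => i.casesOn none e, ?_, ?_, ?_⟩
      · rintro (_ | i) hi
        · rfl
        · exact he i (by simpa using hi)
      · rintro (_ | N)
        · simpa using pow_le_one₀ hq.le hq1
        · rw [Finset.prod_range_succ']
          simpa [updateWeight] using hprod N
      · rw [expertMistakes_cons, hypothesisMistakes_cons]
        change (if z.2 ∈ (optimalList (k := k) V n z.1).1 then (0 : ℝ) else 1) +
          expertMistakes (optimalExpert (V, n) e) S ≤ _
        by_cases h1 : z.2 ∈ (optimalList (k := k) V n z.1).1
        · rw [if_pos h1]
          split_ifs <;> linarith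
        · rw [if_neg h1, if_neg fun h2 => hz ⟨h2, h1⟩]
          linarith

end StandardOptimalAlgorithm

/-! ### A learner for a known horizon. -/

section FiniteHorizon

variable {X Y : Type*} [Fintype Y] [DecidableEq Y] {k k' : ℕ}

/-- The extension by `none` of a finite sequence of optional labels. -/
def extendNone {n : ℕ} (e : Fin n → Option Y) (i : ℕ) : Option Y :=
  if h : i < n then e ⟨i, h⟩ else none

/-- The good schedule has prior at least `q ^ d` out of total mass `(1 + L * q) ^ n`. Its cost in
the exponential weights bound is thus logarithmic in the number of schedules with about `d` updates,
and the extra `d` counts the update rounds. -/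
lemma exists_learner_horizon (hk : k ≤ Fintype.card Y) {H : Set (MultiHypothesis X Y k')}
    {d n : ℕ} (hd : 0 < d) (hdn : d ≤ n) (hY : 0 < Fintype.card Y)
    (hH : ¬ ShattersDepth k H (d + 1)) :
    ∃ A : ListLearner X Y k, ∀ S : Pattern X Y, S.length ≤ n → ∀ h ∈ H,
      learnerMistakes A S ≤ hypothesisMistakes h S + d +
        2 * √(d * n * (1 + Real.log (n * Fintype.card Y / d))) := by
  obtain ⟨L₀, -, hL₀⟩ := Finset.exists_subset_card_eq (s := (Finset.univ : Finset Y)) hk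
  have : Nonempty (KList Y k) := ⟨⟨L₀, hL₀⟩⟩
  have hd0 : (0 : ℝ) < d := by exact_mod_cast hd
  have hn0 : (0 : ℝ) < n := by exact_mod_cast hd.trans_le hdn
  have hdn' : (d : ℝ) ≤ n := by exact_mod_cast hdn
  have hL1 : (1 : ℝ) ≤ Fintype.card Y := by exact_mod_cast hY
  have hL0 : (0 : ℝ) < Fintype.card Y := by linarith
  set L : ℝ := (Fintype.card Y : ℝ) with hL
  -- This makes `n * L * q = d`, so the total prior mass is at most `exp d`.
  set q : ℝ := d / (n * L) with hqdef
  have hq : 0 < q := by positivity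
  have hnL : (n : ℝ) ≤ n * L := le_mul_of_one_le_right hn0.le hL1
  have hq1 : q ≤ 1 := (div_le_one (by positivity)).2 (hdn'.trans hnL)
  set l := 1 + Real.log (n * L / d) with hl
  have hl1 : 1 ≤ l := by
    have : 0 ≤ Real.log (n * L / d) :=
      Real.log_nonneg ((one_le_div hd0).2 (hdn'.trans hnL))
    linarith
  set G : ℝ := d * l with hG
  have hG0 : 0 < G := by positivity
  -- This rate balances the two error terms: `G / η = η * n`.
  set η := √(G / n) with hη
  have hη0 : 0 < η := Real.sqrt_pos.2 (by positivity)
  have hηsq : η * η = G / n := Real.mul_self_sqrt (by positivity)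
  have hp : ∀ e : Fin n → Option Y, 0 < ∏ i, updateWeight q (e i) := fun e =>
    Finset.prod_pos fun i _ => by
      cases e i
      · exact one_pos
      · exact hq
  refine ⟨hedge (fun e : Fin n → Option Y => optimalExpert (k := k) (H, d) (extendNone e))
    (fun e => ∏ i, updateWeight q (e i)) hp η, fun S hS h hh => ?_⟩
  obtain ⟨e, he, hprod, hle⟩ := exists_optimalExpert_le hk hq h S H d hh hH hq1
  -- Nothing is lost by truncating to `n` rounds, as `e` prescribes no update from round `S.length ≤
  -- n` on.
  have hext : extendNone (fun i : Fin n => e i) = e := by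
    funext i
    unfold extendNone
    split_ifs with hi
    · rfl
    · exact (he i (by omega)).symm
  have hreg := learnerMistakes_hedge_le
    (fun e : Fin n → Option Y => optimalExpert (k := k) (H, d) (extendNone e))
    (fun e => ∏ i, updateWeight q (e i)) hp hη0 S fun i => e i
  simp only [hext, sum_prod_updateWeight] at hreg
  have hprodn := hprod n
  rw [← Fin.prod_univ_eq_prod_range fun i => updateWeight q (e i)] at hprodn
  have hlog : Real.log ((1 + L * q) ^ n / ∏ i : Fin n, updateWeight q (e i)) ≤ G := by
    have hbase : 0 < 1 + L * q := by positivity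
    rw [Real.log_div (pow_pos hbase n).ne' (hp fun i => e i).ne', Real.log_pow]
    have h1 : Real.log (1 + L * q) ≤ L * q := by
      have := Real.log_le_sub_one_of_pos hbase
      linarith
    have h2 : n * Real.log (1 + L * q) ≤ d := by
      calc n * Real.log (1 + L * q) ≤ n * (L * q) := by gcongr
        _ = d := by rw [hqdef]; field_simp
    have h3 := Real.log_le_log (pow_pos hq d) hprodn
    rw [Real.log_pow] at h3
    have h4 : Real.log q = -Real.log (n * L / d) := by
      rw [← Real.log_inv, inv_div]
    rw [h4] at h3
    rw [hG, hl]
    linarith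
  have hA : Real.log ((1 + L * q) ^ n / ∏ i : Fin n, updateWeight q (e i)) / η ≤ G / η := by
    gcongr
  have hB : η * S.length ≤ η * n := by
    have : (S.length : ℝ) ≤ n := by exact_mod_cast hS
    gcongr
  have hC : G / η = η * n := by
    rw [div_eq_iff hη0.ne', mul_right_comm, hηsq]
    field_simp
  have hD : η * n = √(d * n * l) := by
    rw [hη, eq_comm, Real.sqrt_eq_iff_mul_self_eq (by positivity) (by positivity)]
    have : √(G / n) * n * (√(G / n) * n) = (√(G / n) * √(G / n)) * (n * n) := by ring
    rw [this, Real.mul_self_sqrt (by positivity), hG]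
    field_simp
  rw [← hD]
  linarith

end FiniteHorizon

/-! ### The doubling trick. -/

section Doubling

variable {X Y : Type*} [Fintype Y] [DecidableEq Y] {k k' : ℕ}

/-- The learner that restarts with the learner `B m` before the example number `2 ^ m`. -/
def doublingLearner (B : ℕ → ListLearner X Y k) : ListLearner X Y k :=
  fun S => B (Nat.log 2 (S.length + 1)) (S.drop (2 ^ Nat.log 2 (S.length + 1) - 1))

/-- Blocks `0, …, N - 1` have total length `2 ^ N - 1`, so block `N` starts after that many examples
and has length at most `2 ^ N`. The mistakes of the fixed `h` add up exactly over the blocks. -/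
lemma learnerMistakes_doublingLearner_le (B : ℕ → ListLearner X Y k) (F : ℕ → ℝ)
    (hF : ∀ m, 0 ≤ F m) (h : MultiHypothesis X Y k')
    (hB : ∀ m (S : Pattern X Y), S.length ≤ 2 ^ m →
      learnerMistakes (B m) S ≤ hypothesisMistakes h S + F m) (N : ℕ) (S : Pattern X Y)
    (hS : S.length + 1 ≤ 2 ^ N) :
    learnerMistakes (doublingLearner B) S ≤
      hypothesisMistakes h S + ∑ m ∈ Finset.range N, F m := by
  induction N generalizing S with
  | zero =>
    have : S = [] := List.length_eq_zero_iff.1 (by simpa using hS)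
    subst this
    simp [learnerMistakes_eq_cumLoss, hypothesisMistakes]
  | succ N ih =>
    rw [Finset.sum_range_succ]
    by_cases hSN : S.length + 1 ≤ 2 ^ N
    · linarith [ih S hSN, hF N]
    have hpow : 1 ≤ 2 ^ N := Nat.one_le_two_pow
    rw [pow_succ] at hS
    obtain ⟨S₁, S₂, rfl, h1⟩ : ∃ S₁ S₂, S = S₁ ++ S₂ ∧ S₁.length = 2 ^ N - 1 :=
      ⟨S.take (2 ^ N - 1), S.drop (2 ^ N - 1), (List.take_append_drop _ _).symm, by
        rw [List.length_take]; omega⟩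
    rw [List.length_append, h1] at hS
    have h2 : learnerMistakes (doublingLearner B) (S₁ ++ S₂) =
        learnerMistakes (doublingLearner B) S₁ + learnerMistakes (B N) S₂ := by
      simp only [learnerMistakes_eq_cumLoss, cumLoss_append]
      congr 1
      refine cumLoss_congr fun P z hP => ?_
      have hlen : (S₁ ++ P).length + 1 = 2 ^ N + P.length := by
        rw [List.length_append, h1]; omega
      have hlog : Nat.log 2 ((S₁ ++ P).length + 1) = N := by
        rw [Nat.log_eq_iff (Or.inr ⟨by norm_num, by omega⟩), hlen, pow_succ]
        omega
      unfold doublingLearner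
      rw [hlog, ← h1, List.drop_left]
    rw [h2, hypothesisMistakes_append]
    push_cast
    linarith [ih S₁ (by omega), hB N S₂ (by omega)]

lemma sum_sqrt_two_pow_le (N : ℕ) : ∑ m ∈ Finset.range N, √((2 : ℝ) ^ m) ≤ 3 * √(2 ^ N) := by
  induction N with
  | zero => simp
  | succ N ih =>
    rw [Finset.sum_range_succ, pow_succ, Real.sqrt_mul (by positivity)]
    -- The induction step needs `3 + 1 ≤ 3 * √2`.
    have h2 : (4 / 3 : ℝ) ≤ √2 := Real.le_sqrt_of_sq_le (by norm_num)
    nlinarith [Real.sqrt_nonneg ((2 : ℝ) ^ N)]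

end Doubling

/-! ### Regret bounds for all horizons, and learnability. -/

section UpperBound

variable {X Y : Type*} [Fintype Y] [DecidableEq Y] {k k' : ℕ}

/-- In dimension `0`, at most `k` labels occur at each point among the hypotheses of `H`, and a
fixed list holds them all. This case is separate because the prior factor `d / (n * L)` would
vanish. -/
lemma exists_learner_nonpos_regret (hk : k ≤ Fintype.card Y) {H : Set (MultiHypothesis X Y k')}
    (hH : ¬ ShattersDepth k H 1) :
    ∃ A : ListLearner X Y k, ∀ S : Pattern X Y, ∀ h ∈ H,
      learnerMistakes A S ≤ hypothesisMistakes h S := by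
  choose P hP using exists_kList_of_not_shattersDepth (n := 0) hk hH
  refine ⟨fun _ x => ⟨Pi.single (P x) 1, single_mem_stdSimplex ℝ (P x)⟩, fun S h hh => ?_⟩
  induction S with
  | nil => simp [learnerMistakes_eq_cumLoss]
  | cons z S ih =>
    rw [learnerMistakes_eq_cumLoss] at ih ⊢
    rw [cumLoss_cons, hypothesisMistakes_cons]
    refine add_le_add ?_ ih
    by_cases hz : z.2 ∈ (h z.1).1
    · rw [if_pos hz]
      have hmem : z.2 ∈ (P z.1).1 := hP _ _ (shattersDepth_zero ⟨h, hh, hz⟩)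
      refine (Finset.sum_eq_zero fun L _ => ?_).le
      split_ifs with hL
      · rfl
      · have : L ≠ P z.1 := fun h => hL (h ▸ hmem)
        simp [this]
    · rw [if_neg hz]
      exact missProb_le_one _ _

lemma exists_learner_regret_le (hk : k ≤ Fintype.card Y) {H : Set (MultiHypothesis X Y k')}
    {d : ℕ} (hd : 0 < d) (hY : 0 < Fintype.card Y) (hH : ¬ ShattersDepth k H (d + 1)) :
    ∃ A : ListLearner X Y k, ∀ S : Pattern X Y, (d : ℝ) ≤ S.length * Fintype.card Y → ∀ h ∈ H,
      learnerMistakes A S ≤ hypothesisMistakes h S +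
        13 * √(d * S.length * (1 + Real.log (S.length * Fintype.card Y / d))) := by
  obtain ⟨L₀, -, hL₀⟩ := Finset.exists_subset_card_eq (s := (Finset.univ : Finset Y)) hk
  have : Nonempty (KList Y k) := ⟨⟨L₀, hL₀⟩⟩
  have hd0 : (0 : ℝ) < d := by exact_mod_cast hd
  have hL1 : (1 : ℝ) ≤ Fintype.card Y := by exact_mod_cast hY
  set L : ℝ := (Fintype.card Y : ℝ) with hL
  -- Blocks shorter than `d` are charged their maximal length.
  let F : ℕ → ℝ := fun m => if d ≤ 2 ^ m then
    d + 2 * √(d * (2 ^ m : ℕ) * (1 + Real.log ((2 ^ m : ℕ) * L / d))) else 2 ^ m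
  have hex : ∀ m, ∃ A : ListLearner X Y k, ∀ S : Pattern X Y, S.length ≤ 2 ^ m → ∀ h ∈ H,
      learnerMistakes A S ≤ hypothesisMistakes h S + F m := by
    intro m
    by_cases hm : d ≤ 2 ^ m
    · obtain ⟨A, hA⟩ := exists_learner_horizon hk hd hm hY hH
      refine ⟨A, fun S hS h hh => ?_⟩
      simp only [F, if_pos hm]
      linarith [hA S hS h hh]
    · refine ⟨fun _ _ => ⟨Pi.single (Classical.arbitrary _) 1, single_mem_stdSimplex ℝ _⟩,
        fun S hS h hh => (learnerMistakes_le_length _ S).trans ?_⟩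
      simp only [F, if_neg hm]
      have h1 : (S.length : ℝ) ≤ 2 ^ m := by exact_mod_cast hS
      have h2 : (0 : ℝ) ≤ hypothesisMistakes h S := Nat.cast_nonneg _
      linarith
  have hF : ∀ m, 0 ≤ F m := fun m => by
    simp only [F]
    split_ifs <;> positivity
  choose B hB using hex
  refine ⟨doublingLearner B, fun S hS h hh => ?_⟩
  set T := S.length with hT
  have hT0 : T ≠ 0 := by
    intro h0
    rw [h0] at hS
    simp at hS
    omega
  have hT0' : (0 : ℝ) < T := by exact_mod_cast Nat.pos_of_ne_zero hT0
  refine (learnerMistakes_doublingLearner_le B F hF h (fun m S hS => hB m S hS h hh)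
    (Nat.log 2 T + 1) S (Nat.lt_pow_succ_log_self (by norm_num) T)).trans ?_
  set N := Nat.log 2 T
  set l := 1 + Real.log (T * L / d) with hl
  have hl1 : 1 ≤ l := by
    have := Real.log_nonneg ((one_le_div hd0).2 hS)
    linarith
  -- The factor `3` is `2` from the horizon bound plus `1` for the additive `d`, which is at most
  -- `√(d * l * 2 ^ m)` once `d ≤ 2 ^ m`.
  have hFle : ∀ m ∈ Finset.range (N + 1), F m ≤ 3 * √(d * l) * √((2 : ℝ) ^ m) := by
    intro m hm
    have hmT : 2 ^ m ≤ T := Nat.pow_le_of_le_log hT0 (by have := Finset.mem_range.1 hm; omega)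
    have hmT' : ((2 ^ m : ℕ) : ℝ) ≤ T := by exact_mod_cast hmT
    have h2m : (0 : ℝ) < 2 ^ m := by positivity
    have hdl : (d : ℝ) ≤ d * l := le_mul_of_one_le_right hd0.le hl1
    rw [mul_assoc, ← Real.sqrt_mul (by positivity)]
    by_cases hmd : d ≤ 2 ^ m
    · simp only [F, if_pos hmd]
      have hmd' : (d : ℝ) ≤ 2 ^ m := by exact_mod_cast hmd
      have h1 : (d : ℝ) ≤ √(d * l * 2 ^ m) := by
        refine Real.le_sqrt_of_sq_le ?_
        rw [sq]
        gcongr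
      have h2 : √(d * (2 ^ m : ℕ) * (1 + Real.log ((2 ^ m : ℕ) * L / d))) ≤
          √(d * l * 2 ^ m) := by
        refine Real.sqrt_le_sqrt ?_
        rw [mul_right_comm]
        push_cast at hmT' ⊢
        have : Real.log (2 ^ m * L / d) ≤ Real.log (T * L / d) :=
          Real.log_le_log (by positivity) (by gcongr)
        rw [hl]
        gcongr
      linarith
    · simp only [F, if_neg hmd]
      have hmd' : (2 : ℝ) ^ m ≤ d := by exact_mod_cast (not_le.1 hmd).le
      have h1 : (2 : ℝ) ^ m ≤ √(d * l * 2 ^ m) := by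
        refine Real.le_sqrt_of_sq_le ?_
        rw [sq]
        gcongr
        exact hmd'.trans hdl
      linarith [Real.sqrt_nonneg (d * l * 2 ^ m)]
  have hNT : (2 : ℝ) ^ N ≤ T := by exact_mod_cast Nat.pow_log_le_self 2 hT0
  -- The final constant is `13 = 3 * 3 * (13 / 9)`.
  have h2 : √(2 : ℝ) ≤ 13 / 9 := Real.sqrt_le_iff.2 (by norm_num)
  have hs : √((2 : ℝ) ^ (N + 1)) ≤ √T * (13 / 9) := by
    rw [pow_succ, Real.sqrt_mul (by positivity)]
    gcongr
  have hsum : ∑ m ∈ Finset.range (N + 1), F m ≤ 13 * √(d * T * l) := by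
    calc ∑ m ∈ Finset.range (N + 1), F m
        ≤ ∑ m ∈ Finset.range (N + 1), 3 * √(d * l) * √((2 : ℝ) ^ m) := Finset.sum_le_sum hFle
      _ = 3 * √(d * l) * ∑ m ∈ Finset.range (N + 1), √((2 : ℝ) ^ m) := by
          rw [Finset.mul_sum]
      _ ≤ 3 * √(d * l) * (3 * √(2 ^ (N + 1))) := by
          gcongr
          exact sum_sqrt_two_pow_le _
      _ ≤ 3 * √(d * l) * (3 * (√T * (13 / 9))) := by gcongr
      _ = 13 * √(d * T * l) := by
          rw [mul_right_comm (d : ℝ), Real.sqrt_mul (by positivity) (T : ℝ)]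
          ring
  linarith

/-- A positive ceiling is at least `1`, so its multiple of `k` dominates both `k` and `L - k`. This
lets the number of labels be replaced by the rounded quantity up to a factor `2`. -/
lemma le_two_mul_ceil_mul {L k : ℝ} (hk : 0 < k) (h : 0 < (⌈(L - k) / k⌉ : ℝ) * k) :
    L ≤ 2 * (⌈(L - k) / k⌉ * k) := by
  have h1 : (0 : ℝ) < ⌈(L - k) / k⌉ := pos_of_mul_pos_left h hk.le
  have h2 : (1 : ℝ) ≤ ⌈(L - k) / k⌉ := by
    have : 0 < ⌈(L - k) / k⌉ := by exact_mod_cast h1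
    exact_mod_cast this
  have h3 : k ≤ ⌈(L - k) / k⌉ * k := le_mul_of_one_le_left hk.le h2
  have h4 : L - k ≤ ⌈(L - k) / k⌉ * k := (div_le_iff₀ hk).1 (Int.le_ceil _)
  linarith

/-- Since `b ≥ 2`, both `1` and `log 2` are absorbed: `1 / log 2 + 1 + 1 < 4`. -/
lemma one_add_log_le {a b : ℝ} (ha : 0 < a) (hab : a ≤ 2 * b) (hb : 2 ≤ b) :
    1 + Real.log a ≤ 4 * Real.log b := by
  have h1 := Real.log_le_log ha hab
  rw [Real.log_mul (by norm_num) (by linarith)] at h1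
  have h2 := Real.log_le_log (by norm_num) hb
  have h3 := Real.log_two_gt_d9
  linarith

lemma exists_learner_regret_le_sqrt (hk1 : 1 ≤ k) (hk : k ≤ Fintype.card Y)
    {H : Set (MultiHypothesis X Y k')} (hH : H.Nonempty) {d : ℕ}
    (hd : ¬ ShattersDepth k H (d + 1)) :
    ∃ A : ListLearner X Y k, ∀ (T : ℕ) (S : Pattern X Y), S.length = T →
      2 * (d : ℝ) ≤ T * (⌈((Fintype.card Y : ℝ) - k) / k⌉ * k) →
        regret H A S ≤
          26 * √(d * T * Real.log (T / d * (⌈((Fintype.card Y : ℝ) - k) / k⌉ * k))) := by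
  rcases Nat.eq_zero_or_pos d with rfl | hd0
  · obtain ⟨A, hA⟩ := exists_learner_nonpos_regret hk hd
    refine ⟨A, fun T S _ _ => regret_le_of_forall hH fun h hh => ?_⟩
    simpa using hA S h hh
  · obtain ⟨A, hA⟩ := exists_learner_regret_le hk hd0 (hk1.trans hk) hd
    refine ⟨A, ?_⟩
    rintro T S rfl hT
    have hd0' : (0 : ℝ) < d := by exact_mod_cast hd0
    have hk0 : (0 : ℝ) < k := by exact_mod_cast hk1
    set b : ℝ := ⌈((Fintype.card Y : ℝ) - k) / k⌉ * k with hb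
    have hTb : 0 < (S.length : ℝ) * b := by linarith
    have hb0 : 0 < b := pos_of_mul_pos_right hTb (Nat.cast_nonneg _)
    have hT0 : (0 : ℝ) < S.length := pos_of_mul_pos_left hTb hb0.le
    have hLb := le_two_mul_ceil_mul (L := Fintype.card Y) hk0 hb0
    have hYpos : (0 : ℝ) < Fintype.card Y := by exact_mod_cast hk1.trans hk
    have hbL : b ≤ Fintype.card Y := by
      have h1 := Int.ceil_lt_add_one (((Fintype.card Y : ℝ) - k) / k)
      have h2 : b < (((Fintype.card Y : ℝ) - k) / k + 1) * k := by
        rw [hb]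
        gcongr
      have h3 : (((Fintype.card Y : ℝ) - k) / k + 1) * k = Fintype.card Y := by field_simp; ring
      linarith
    have hTL : (S.length : ℝ) * b ≤ S.length * Fintype.card Y := by gcongr
    have hlog : 1 + Real.log (S.length * Fintype.card Y / d) ≤
        4 * Real.log (S.length / d * b) := by
      refine one_add_log_le (by positivity) ?_ ?_
      · rw [div_mul_eq_mul_div, ← mul_div_assoc, ← mul_assoc, mul_comm 2, mul_assoc]
        gcongr
      · rw [div_mul_eq_mul_div, le_div_iff₀ hd0']
        exact hT
    refine regret_le_of_forall hH fun h hh => (hA S (by linarith) h hh).trans ?_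
    -- The factor `4` leaves the root as `2`, whence `26 = 2 * 13`.
    have hsqrt : √(d * S.length * (1 + Real.log (S.length * Fintype.card Y / d))) ≤
        2 * √(d * S.length * Real.log (S.length / d * b)) := by
      rw [show (2 : ℝ) = √4 by rw [show (4 : ℝ) = 2 ^ 2 by norm_num]; simp,
        ← Real.sqrt_mul (by norm_num)]
      refine Real.sqrt_le_sqrt ?_
      calc d * S.length * (1 + Real.log (S.length * Fintype.card Y / d))
          ≤ d * S.length * (4 * Real.log (S.length / d * b)) := by gcongr
        _ = 4 * (d * S.length * Real.log (S.length / d * b)) := by ring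
    linarith

lemma isLittleO_sqrt_mul_log (d c C : ℝ) :
    (fun T : ℕ => C * √(d * T * Real.log (T / d * c)) + 2 * d) =o[atTop] fun T : ℕ => (T : ℝ) := by
  have hcast : Tendsto (fun T : ℕ => (T : ℝ)) atTop atTop := tendsto_natCast_atTop_atTop
  have hconst : ∀ a : ℝ, (fun _ : ℕ => a) =o[atTop] fun T : ℕ => (T : ℝ) := fun a =>
    (isLittleO_const_id_atTop a).comp_tendsto hcast
  refine IsLittleO.add (IsLittleO.const_mul_left ?_ C) (hconst _)
  -- This includes `d = 0`, where division by zero and `Real.log 0 = 0` make the root vanish.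
  by_cases hdc : c / d = 0
  · have : (fun T : ℕ => √(d * T * Real.log (T / d * c))) = fun _ => 0 := by
      funext T
      rw [div_mul_eq_mul_div, mul_div_assoc, hdc]
      simp
    rw [this]
    exact isLittleO_zero _ _
  have hlog : (fun T : ℕ => Real.log (T / d * c)) =o[atTop] fun T : ℕ => (T : ℝ) := by
    have h1 : (fun T : ℕ => Real.log T + Real.log (c / d)) =o[atTop] fun T : ℕ => (T : ℝ) :=
      (Real.isLittleO_log_id_atTop.comp_tendsto hcast).add (hconst _)
    refine h1.congr' ?_ EventuallyEq.rfl
    filter_upwards [eventually_gt_atTop 0] with T hT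
    rw [← Real.log_mul (by positivity) hdc, div_mul_eq_mul_div, mul_div_assoc]
  have hprod : (fun T : ℕ => d * T * Real.log (T / d * c)) =o[atTop]
      fun T : ℕ => (T : ℝ) * T :=
    (isBigO_const_mul_self d _ _).mul_isLittleO hlog
  rw [isLittleO_iff] at hprod ⊢
  intro ε hε
  filter_upwards [hprod (sq_pos_of_pos hε)] with T hT
  rw [Real.norm_of_nonneg (Real.sqrt_nonneg _), Real.norm_of_nonneg (Nat.cast_nonneg T)]
  refine Real.sqrt_le_iff.2 ⟨by positivity, (le_abs_self _).trans (hT.trans_eq ?_)⟩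
  rw [Real.norm_of_nonneg (by positivity)]
  ring

lemma agnosticListLearnable_of_littlestoneDim_lt_top (hk1 : 1 ≤ k) (hk : k ≤ Fintype.card Y)
    {H : Set (MultiHypothesis X Y k')} (hH : H.Nonempty)
    (h : littlestoneDim k (patternClass H) < ⊤) : AgnosticListLearnable k H := by
  -- If `k` is the number of labels, no node has `k + 1` distinct edge labels, so `d = 0` serves;
  -- otherwise the ceiling below is positive.
  obtain ⟨d, hd, hdk⟩ : ∃ d, ¬ ShattersDepth k H (d + 1) ∧ (d = 0 ∨ k < Fintype.card Y) := by
    rcases hk.eq_or_lt with hkY | hkY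
    · refine ⟨0, ?_, Or.inl rfl⟩
      rintro ⟨t, -⟩
      cases t with
      | node x y child =>
        have := Fintype.card_le_of_embedding y
        rw [Fintype.card_fin] at this
        omega
    · obtain ⟨d, hd⟩ := ENat.ne_top_iff_exists.1 h.ne
      exact ⟨d, not_shattersDepth_of_littlestoneDim_eq hd.symm, Or.inr hkY⟩
  obtain ⟨A, hA⟩ := exists_learner_regret_le_sqrt hk1 hk hH hd
  refine ⟨A, _, isLittleO_sqrt_mul_log d (⌈((Fintype.card Y : ℝ) - k) / k⌉ * k) 26,
    fun T S hS => ?_⟩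
  have hd0 : (0 : ℝ) ≤ d := Nat.cast_nonneg d
  by_cases hT : 2 * (d : ℝ) ≤ T * (⌈((Fintype.card Y : ℝ) - k) / k⌉ * k)
  · linarith [hA T S hS hT]
  · have hkY : k < Fintype.card Y := hdk.resolve_left fun h0 => hT <| by
      have hkY' : (k : ℝ) ≤ Fintype.card Y := by exact_mod_cast hk
      have hc : (0 : ℝ) ≤ ⌈((Fintype.card Y : ℝ) - k) / k⌉ := by
        have := Int.ceil_nonneg (div_nonneg (sub_nonneg.2 hkY') (Nat.cast_nonneg k))
        exact_mod_cast this
      rw [h0]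
      simp only [Nat.cast_zero, mul_zero]
      positivity
    have hk1' : (1 : ℝ) ≤ k := by exact_mod_cast hk1
    have hkY' : (k : ℝ) < Fintype.card Y := by exact_mod_cast hkY
    have hc : (1 : ℝ) ≤ ⌈((Fintype.card Y : ℝ) - k) / k⌉ := by
      have : 0 < ⌈((Fintype.card Y : ℝ) - k) / k⌉ :=
        Int.ceil_pos.2 (div_pos (sub_pos.2 hkY') (by linarith))
      exact_mod_cast this
    have hTd : (T : ℝ) ≤ T * (⌈((Fintype.card Y : ℝ) - k) / k⌉ * k) :=
      le_mul_of_one_le_right (Nat.cast_nonneg T) (one_le_mul_of_one_le_of_one_le hc hk1')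
    -- Here `T < 2 * d`, so the trivial bound `T` is covered by the summand `2 * d` in the rate.
    refine regret_le_of_forall hH fun g _ => (learnerMistakes_le_length A S).trans ?_
    have h1 : (0 : ℝ) ≤ hypothesisMistakes g S := Nat.cast_nonneg _
    have h2 := Real.sqrt_nonneg
      (d * T * Real.log (T / d * (⌈((Fintype.card Y : ℝ) - k) / k⌉ * k)))
    rw [hS]
    linarith [not_le.1 hT]

end UpperBound

theorem theorem4 :
    ∃ C : ℝ, 0 < C ∧
      ∀ (X : Type*) (Y : Type*) [Fintype Y] [DecidableEq Y] (k k' : ℕ)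
        (_hk : 1 ≤ k) (_hkY : k ≤ Fintype.card Y)
        (_hk' : 1 ≤ k') (_hkY' : k' ≤ Fintype.card Y)
        (H : Set (MultiHypothesis X Y k')) (_hH : H.Nonempty),
        (AgnosticListLearnable k H ↔ littlestoneDim k (patternClass H) < ⊤) ∧
        ∀ d : ℕ, littlestoneDim k (patternClass H) = d →
          ∃ A : ListLearner X Y k, ∀ (T : ℕ) (S : Pattern X Y), S.length = T →
            2 * (d : ℝ) ≤ T * (⌈((Fintype.card Y : ℝ) - k) / k⌉ * k) →
              regret H A S ≤
                C * √(d * T * Real.log (T / d * (⌈((Fintype.card Y : ℝ) - k) / k⌉ * k))) := by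
  refine ⟨26, by norm_num, fun X Y _ _ k k' hk1 hk _ _ H hH => ⟨⟨?_, ?_⟩, fun d hd => ?_⟩⟩
  · exact littlestoneDim_lt_top_of_agnosticListLearnable
  · exact agnosticListLearnable_of_littlestoneDim_lt_top hk1 hk hH
  · exact exists_learner_regret_le_sqrt hk1 hk hH (not_shattersDepth_of_littlestoneDim_eq hd)
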